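/- Theorem 1 (local blindness of min-sum decoding on the toric code). Let $m,n\ge 3$ and consider the toric code on the $m\times n$ square lattice with periodic boundaries: the qubits are the edges of the lattice, the checks are its vertices, and the parity-check matrix $H$ is the vertex–edge incidence matrix over $\mathbb F_2$. Write $\mathcal N(c)$ for the set of four qubits incident to a check $c$, and $\mathcal N(q)$ for the set of two checks incident to a qubit $q$. Let $0<p<1/2$ and give every qubit the same a priori value $\gamma=\log\frac{1-p}{p}$ (i.i.d. errors of probability $p$). For an input vector $\sigma$ assigning a bit to every check, min-sum decoding (with flooded scheduling) computes messages $\nu^{(0)}_{q\to c}=\gamma$ and, for $i\ge 1$, $$\mu^{(i)}_{c\to q}=(-1)^{\sigma(c)}\prod_{q'\in\mathcal N(c)\setminus\{q\}}\operatorname{sgn}\nu^{(i-1)}_{q'\to c}\cdot\min_{q'\in\mathcal N(c)\setminus\{q\}}\bigl|\nu^{(i-1)}_{q'\to c}\bigr|,\qquad \nu^{(i)}_{q\to c}=\gamma+\sum_{c'\in\mathcal N(q)\setminus\{c\}}\mu^{(i)}_{c'\to q},$$ and the a posteriori value of the qubit $q$ at iteration $i$ is $\mathrm{app}_\sigma(q,0)=\gamma$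 and $\mathrm{app}_\sigma(q,i)=\gamma+\sum_{c\in\mathcal N(q)}\mu^{(i)}_{c\to q}$ for $i\ge1$. Let $\mathbf s=H\mathbf e$ be the syndrome of an error $\mathbf e$, and suppose that any two distinct unsatisfied checks (checks $c$ with $\mathbf s(c)=1$) are at distance at least $5$ in the lattice (graph distance). Then min-sum decoding of $\mathbf s$ is locally blind in the neighborhood of every unsatisfied check $c$: for every qubit $q\in\mathcal N(c)$ and every iteration $i\ge 0$, $$\mathrm{app}_{\mathbf s}(q,i)=\mathrm{app}_{\mathbf s^c}(q,i),$$ where $\mathbf s^c$ is the fake syndrome in which $c$ is the only unsatisfied check. -/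

import Mathlib

noncomputable section

/-! ### Min-sum decoding on the Tanner graph of a binary parity-check matrix -/

section MinSum

variable {C Q : Type*} [Fintype C] [DecidableEq C] [Fintype Q] [DecidableEq Q]

/-- The qubits taking part in the check `c`: its neighbours in the Tanner graph of `H`. -/
def checkNbhd (H : Matrix C Q (ZMod 2)) (c : C) : Finset Q :=
  Finset.univ.filter fun q => H c q = 1

/-- The checks in which the qubit `q` takes part: its neighbours in the Tanner graph of `H`. -/
def qubitNbhd (H : Matrix C Q (ZMod 2)) (q : Q) : Finset C :=
  Finset.univ.filter fun c => H c q = 1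

/-- The min-sum message from the check `c` to the qubit `q`, computed from the extrinsic incoming
messages `ν q' c`, where `q'` runs over the neighbours of `c` other than `q`:
`(-1) ^ s(c) * ∏ sgn (ν q' c) * min |ν q' c|`.
(The value `0` for an empty set of incoming messages is a convention that is not used for toric
codes, where every check has four neighbours.) -/
def checkToQubit (H : Matrix C Q (ZMod 2)) (s : C → ZMod 2) (ν : Q → C → ℝ) (c : C) (q : Q) : ℝ :=
  if h : ((checkNbhd H c).erase q).Nonempty then
    (if s c = 1 then -1 else 1) *
      (∏ q' ∈ (checkNbhd H c).erase q, Real.sign (ν q' c)) *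
      ((checkNbhd H c).erase q).inf' h (fun q' => |ν q' c|)
  else 0

/-- The min-sum messages from qubits to checks after `i` iterations (flooded scheduling), for the
parity-check matrix `H`, the a priori values `γ` and the input syndrome `s`. -/
def qubitToCheck (H : Matrix C Q (ZMod 2)) (γ : Q → ℝ) (s : C → ZMod 2) : ℕ → Q → C → ℝ
  | 0 => fun q _ => γ q
  | i + 1 => fun q c =>
      γ q + ∑ c' ∈ (qubitNbhd H q).erase c, checkToQubit H s (qubitToCheck H γ s i) c' q

/-- The a posteriori value of the qubit `q` at iteration `i` of min-sum decoding with a priori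
values `γ` and input syndrome `s`; at iteration `0` no check message has been received. -/
def minSumApp (H : Matrix C Q (ZMod 2)) (γ : Q → ℝ) (s : C → ZMod 2) (q : Q) : ℕ → ℝ
  | 0 => γ q
  | i + 1 => γ q + ∑ c ∈ qubitNbhd H q, checkToQubit H s (qubitToCheck H γ s i) c q

/-- The fake syndrome in which `c` is the only unsatisfied check. -/
def fakeSyndrome (c : C) : C → ZMod 2 := fun c' => if c' = c then 1 else 0

/-- Min-sum decoding of `s` is locally blind in the neighbourhood of `c`: at every iteration, every
qubit neighbouring `c` has the same a posteriori value as if `c` were the only unsatisfied check. -/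
def MinSumLocallyBlind (H : Matrix C Q (ZMod 2)) (γ : Q → ℝ) (s : C → ZMod 2) (c : C) : Prop :=
  ∀ q ∈ checkNbhd H c, ∀ i : ℕ, minSumApp H γ s q i = minSumApp H γ (fakeSyndrome c) q i

/-- The a priori values for i.i.d. errors of probability `p`: the same log-likelihood ratio
`log ((1 - p) / p)` for all qubits. -/
def iidPrior (p : ℝ) : Q → ℝ := fun _ => Real.log ((1 - p) / p)

end MinSum

/-! ### The toric code on the `m × n` square lattice with periodic boundaries -/

/-- Checks are the vertices of the lattice. -/
abbrev ToricCheck (m n : ℕ) : Type := ZMod m × ZMod n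

/-- Qubits are the edges of the lattice: `(v, false)` is the edge joining `v` to `v + (1, 0)` and
`(v, true)` is the edge joining `v` to `v + (0, 1)`. -/
abbrev ToricQubit (m n : ℕ) : Type := ToricCheck m n × Bool

/-- The second endpoint of an edge of the lattice; the first endpoint of `q` is `q.1`. -/
def toricTarget {m n : ℕ} (q : ToricQubit m n) : ToricCheck m n :=
  if q.2 then q.1 + (0, 1) else q.1 + (1, 0)

/-- The parity-check matrix: the vertex-edge incidence matrix of the lattice. -/
def toricH (m n : ℕ) : Matrix (ToricCheck m n) (ToricQubit m n) (ZMod 2) :=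
  fun c q => if c = q.1 ∨ c = toricTarget q then 1 else 0

/-- The lattice as a graph: two distinct checks are adjacent if they share a qubit. -/
def toricLattice (m n : ℕ) : SimpleGraph (ToricCheck m n) where
  Adj c c' := c ≠ c' ∧ ∃ q, toricH m n c q = 1 ∧ toricH m n c' q = 1
  symm := ⟨fun _ _ h => ⟨h.1.symm, h.2.imp fun _ hq => hq.symm⟩⟩
  loopless := ⟨fun _ h => h.1 rfl⟩

end

/-! Scale the prior to 1. The qubit on an edge `vw` then sends to `w` the message 1 ± (signed
minimum of the messages entering `v` from its neighbours other than `w`), and its a posteriori value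
is the sum of its two messages minus 1. So it suffices that the two messages on an edge at an
unsatisfied check obey a recursion that ignores all other unsatisfied checks.

A signed minimum equals one of its entries as soon as every other entry is at least the absolute
value of that entry (`signedMin_eq_of_dominated`). Far messages therefore need only a lower bound.
The invariants `SquareInvariant` and `TriangleInvariant` give exact values for a few types of edges
near each unsatisfied check, and one lower bound for messages leaving vertices neither unsatisfied
nor adjacent to an unsatisfied check. Distance five keeps the neighbourhoods from interfering. The
values form an integer recursion, eventually of period six, so the inequalities behind each
domination are checked on finitely many states.

If both periods are at least 4, the square picture applies. If one is 3 and the other at least 5, a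
triangle passes through every check and a second recursion is needed. In the remaining cases the
diameter is at most 4, so the syndrome is already the fake one. The fake syndrome is trivially well
spaced, so it satisfies the same invariant with the same values. -/

/-! ### Signed minima and domination. -/

section SignedMin

variable {ι : Type*}

/-- The product of the signs times the minimum of the absolute values of a family of reals. -/
noncomputable def signedMin (T : Finset ι) (x : ι → ℝ) : ℝ :=
  if h : T.Nonempty then (∏ i ∈ T, Real.sign (x i)) * T.inf' h (fun i => |x i|) else 0

/-- The signed minimum of two reals. -/
noncomputable def signedMin₂ (u w : ℝ) : ℝ := Real.sign u * Real.sign w * min |u| |w|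

theorem signedMin_congr {T : Finset ι} {x y : ι → ℝ} (h : ∀ i ∈ T, x i = y i) :
    signedMin T x = signedMin T y := by
  unfold signedMin
  split_ifs with hT
  · rw [Finset.prod_congr rfl (fun i hi => by rw [h i hi])]
    congr 1
    exact Finset.inf'_congr hT rfl (fun i hi => by rw [h i hi])
  · rfl

theorem prod_sign_of_pos {T : Finset ι} {x : ι → ℝ} (h : ∀ i ∈ T, 0 < x i) :
    ∏ i ∈ T, Real.sign (x i) = 1 :=
  Finset.prod_eq_one fun i hi => Real.sign_of_pos (h i hi)

theorem abs_sign_le_one (x : ℝ) : |Real.sign x| ≤ 1 := by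
  rcases Real.sign_apply_eq x with h | h | h <;> simp [h]

theorem abs_signedMin_le {T : Finset ι} {x : ι → ℝ} {i : ι} (hi : i ∈ T) :
    |signedMin T x| ≤ |x i| := by
  have hT : T.Nonempty := ⟨i, hi⟩
  have h0 : 0 ≤ T.inf' hT (fun i => |x i|) := by simp
  rw [signedMin, dif_pos hT, abs_mul, abs_of_nonneg h0, Finset.abs_prod]
  calc _ ≤ 1 * T.inf' hT (fun i => |x i|) := by
        gcongr
        exact Finset.prod_le_one (fun _ _ => abs_nonneg _) fun _ _ => abs_sign_le_one _
    _ ≤ |x i| := by rw [one_mul]; exact Finset.inf'_le (fun i => |x i|) hi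

theorem le_signedMin {T : Finset ι} {x : ι → ℝ} {r : ℝ} (hT : T.Nonempty) (hr : 0 ≤ r)
    (h : ∀ i ∈ T, r ≤ x i) : r ≤ signedMin T x := by
  rw [signedMin, dif_pos hT]
  have hle : r ≤ T.inf' hT (fun i => |x i|) :=
    (Finset.le_inf'_iff _ _).2 fun i hi => (h i hi).trans (le_abs_self _)
  -- Zero messages do occur in the recursions; for r = 0 the product of signs may vanish, and only
  -- its nonnegativity is available.
  rcases hr.eq_or_lt with rfl | hr
  · refine mul_nonneg (Finset.prod_nonneg fun i hi => ?_) hle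
    rcases (h i hi).eq_or_lt with h | h
    · simp [← h]
    · simp [Real.sign_of_pos h]
  · rwa [prod_sign_of_pos fun i hi => hr.trans_le (h i hi), one_mul]

/-- This propagates the far lower bound: `C` is a message leaving the vicinity of an unsatisfied
check, `E` the current bound. A negative `C` that occurs caps the absolute value at |C|; if it does
not occur, all entries are nonnegative. -/
theorem signedMin_ge_of_eq_or_ge {T : Finset ι} {x : ι → ℝ} {C E : ℝ} (hT : T.Nonempty)
    (hCE : |C| ≤ E) (h : ∀ i ∈ T, x i = C ∨ E ≤ x i) : C ≤ signedMin T x := by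
  by_cases hC : 0 ≤ C
  · refine le_signedMin hT hC fun i hi => ?_
    rcases h i hi with h | h
    · exact h.ge
    · exact ((le_abs_self C).trans hCE).trans h
  · push Not at hC
    by_cases hex : ∃ i ∈ T, x i = C
    · obtain ⟨i, hi, hx⟩ := hex
      have := abs_signedMin_le (x := x) hi
      rw [hx, abs_of_neg hC] at this
      linarith [neg_abs_le (signedMin T x)]
    · push Not at hex
      have : 0 ≤ signedMin T x := le_signedMin hT le_rfl fun i hi =>
        ((abs_nonneg C).trans hCE).trans ((h i hi).resolve_left (hex i hi))
      linarith

open Classical in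
-- The mechanism of blindness: the other entries are positive and no smaller in absolute value,
-- unless `x i = 0`, when both sides vanish.
theorem signedMin_eq_of_dominated {T : Finset ι} {x : ι → ℝ} {i : ι} (hi : i ∈ T)
    (h : ∀ j ∈ T, j ≠ i → |x i| ≤ x j) : signedMin T x = x i := by
  have hT : T.Nonempty := ⟨i, hi⟩
  have hinf : T.inf' hT (fun i => |x i|) = |x i| := by
    refine le_antisymm (Finset.inf'_le (fun i => |x i|) hi)
      ((Finset.le_inf'_iff _ _).2 fun j hj => ?_)
    by_cases hji : j = i
    · rw [hji]
    · exact (h j hj hji).trans (le_abs_self _)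
  rw [signedMin, dif_pos hT, hinf]
  by_cases hx : x i = 0
  · simp [hx]
  · rw [← Finset.mul_prod_erase _ _ hi, prod_sign_of_pos, mul_one]
    · rcases lt_or_gt_of_ne hx with h | h
      · simp [Real.sign_of_neg h, abs_of_neg h]
      · simp [Real.sign_of_pos h, abs_of_pos h]
    · intro j hj
      rw [Finset.mem_erase] at hj
      exact (abs_pos.2 hx).trans_le (h j hj.2 hj.1)

open Classical in
theorem signedMin_eq_signedMin₂ {T : Finset ι} {x : ι → ℝ} {i j : ι} (hi : i ∈ T) (hj : j ∈ T)
    (hij : i ≠ j) (h : ∀ k ∈ T, k ≠ i → k ≠ j → min |x i| |x j| ≤ x k) :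
    signedMin T x = signedMin₂ (x i) (x j) := by
  have hT : T.Nonempty := ⟨i, hi⟩
  have hinf : T.inf' hT (fun i => |x i|) = min |x i| |x j| := by
    refine le_antisymm (le_min (Finset.inf'_le (fun i => |x i|) hi)
      (Finset.inf'_le (fun i => |x i|) hj)) ((Finset.le_inf'_iff _ _).2 fun k hk => ?_)
    by_cases hki : k = i
    · rw [hki]; exact min_le_left _ _
    by_cases hkj : k = j
    · rw [hkj]; exact min_le_right _ _
    exact (h k hk hki hkj).trans (le_abs_self _)
  rw [signedMin, dif_pos hT, hinf, signedMin₂]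
  by_cases hx : x i = 0 ∨ x j = 0
  · rcases hx with hx | hx <;> simp [hx]
  · push Not at hx
    rw [← Finset.mul_prod_erase _ _ hi,
      ← Finset.mul_prod_erase _ _ (Finset.mem_erase.2 ⟨hij.symm, hj⟩), prod_sign_of_pos, mul_one]
    intro k hk
    simp only [Finset.mem_erase] at hk
    exact (lt_min (abs_pos.2 hx.1) (abs_pos.2 hx.2)).trans_le (h k hk.2.2 hk.2.1 hk.1)

theorem signedMin_const_mul {T : Finset ι} {x : ι → ℝ} {g : ℝ} (hg : 0 < g) :
    signedMin T (fun i => g * x i) = g * signedMin T x := by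
  unfold signedMin
  split_ifs with hT
  · have h1 : ∀ y : ℝ, Real.sign (g * y) = Real.sign y := fun y => by
      rcases lt_trichotomy y 0 with h | rfl | h
      · rw [Real.sign_of_neg h, Real.sign_of_neg (mul_neg_of_pos_of_neg hg h)]
      · simp
      · rw [Real.sign_of_pos h, Real.sign_of_pos (mul_pos hg h)]
    have h2 : T.inf' hT (fun i => |g * x i|) = g * T.inf' hT (fun i => |x i|) := by
      rw [Finset.apply_inf'_eq_inf'_comp hT (fun y => g * y)
        fun a b => mul_min_of_nonneg a b hg.le]
      exact Finset.inf'_congr hT rfl fun i _ => by simp [abs_mul, abs_of_pos hg]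
    simp only [h1, h2]
    ring
  · simp

theorem signedMin_image [DecidableEq ι] {κ : Type*} {T : Finset κ} {f : κ → ι} {x : ι → ℝ}
    (hf : Set.InjOn f T) : signedMin (T.image f) x = signedMin T (x ∘ f) := by
  unfold signedMin
  by_cases hT : T.Nonempty
  · rw [dif_pos hT, dif_pos (hT.image f), Finset.prod_image hf, Finset.inf'_image]
    rfl
  · rw [dif_neg hT, dif_neg (by simpa using hT)]

theorem intCast_signedMin₂ (a b : ℤ) :
    signedMin₂ a b = ((a.sign * b.sign * min |a| |b| : ℤ) : ℝ) := by
  simp [signedMin₂, Real.sign_intCast]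

end SignedMin

/-! ### Messages along directed edges of a graph. -/

section GraphMessages

variable {V : Type*} [Fintype V] [DecidableEq V]

open Classical in
/-- The neighbours of `v` other than `w`. -/
noncomputable def otherNbrs (G : SimpleGraph V) (v w : V) : Finset V :=
  Finset.univ.filter fun u => G.Adj v u ∧ u ≠ w

@[simp] theorem mem_otherNbrs {G : SimpleGraph V} {u v w : V} :
    u ∈ otherNbrs G v w ↔ G.Adj v u ∧ u ≠ w := by
  simp [otherNbrs]

/-- Min-sum messages with unit prior along the directed edges of a graph whose vertices are the
checks and whose edges are the qubits. -/
noncomputable def edgeMsg (G : SimpleGraph V) (s : V → ZMod 2) : ℕ → V → V → ℝ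
  | 0 => fun _ _ => 1
  | t + 1 => fun v w =>
      1 + (if s v = 1 then -1 else 1) * signedMin (otherNbrs G v w) fun u => edgeMsg G s t u v

theorem edgeMsg_succ (G : SimpleGraph V) (s : V → ZMod 2) (t : ℕ) (v w : V) :
    edgeMsg G s (t + 1) v w =
      1 + (if s v = 1 then -1 else 1) * signedMin (otherNbrs G v w) fun u => edgeMsg G s t u v :=
  rfl

theorem edgeMsg_succ_unsat {G : SimpleGraph V} {s : V → ZMod 2} {v : V} (hv : s v = 1) (t : ℕ)
    (w : V) : edgeMsg G s (t + 1) v w =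
      1 - signedMin (otherNbrs G v w) fun u => edgeMsg G s t u v := by
  simp [edgeMsg_succ, hv, sub_eq_add_neg]

theorem edgeMsg_succ_sat {G : SimpleGraph V} {s : V → ZMod 2} {v : V} (hv : s v ≠ 1) (t : ℕ)
    (w : V) : edgeMsg G s (t + 1) v w =
      1 + signedMin (otherNbrs G v w) fun u => edgeMsg G s t u v := by
  simp [edgeMsg_succ, hv]

end GraphMessages

/-! ### From the Tanner graph to directed edges. -/

section Transfer

variable {C Q : Type*}

/-- `H` is the incidence matrix of the simple graph `G`. -/
structure IsIncidence (G : SimpleGraph C) (H : Matrix C Q (ZMod 2)) : Prop where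
  ends : ∀ q, ∃ v w, v ≠ w ∧ ∀ c, H c q = 1 ↔ c = v ∨ c = w
  unique : ∀ v w q q', v ≠ w → H v q = 1 → H w q = 1 → H v q' = 1 → H w q' = 1 → q = q'
  adj : ∀ v w, G.Adj v w ↔ v ≠ w ∧ ∃ q, H v q = 1 ∧ H w q = 1

variable {G : SimpleGraph C} {H : Matrix C Q (ZMod 2)}

namespace IsIncidence

theorem eq_or_eq (hG : IsIncidence G H) {q : Q} {v w c : C} (hvw : v ≠ w) (hv : H v q = 1)
    (hw : H w q = 1) (hc : H c q = 1) : c = v ∨ c = w := by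
  obtain ⟨a, b, -, h⟩ := hG.ends q
  rw [h] at hv hw hc
  rcases hv with rfl | rfl <;> rcases hw with rfl | rfl <;> rcases hc with rfl | rfl <;> simp_all

theorem exists_other (hG : IsIncidence G H) {q : Q} {v : C} (hv : H v q = 1) :
    ∃ w, w ≠ v ∧ H w q = 1 := by
  obtain ⟨a, b, hab, h⟩ := hG.ends q
  rcases (h v).1 hv with rfl | rfl
  · exact ⟨b, hab.symm, (h b).2 (Or.inr rfl)⟩
  · exact ⟨a, hab, (h a).2 (Or.inl rfl)⟩

variable [Fintype C] [DecidableEq C]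

theorem qubitNbhd_eq (hG : IsIncidence G H) {q : Q} {v w : C} (hvw : v ≠ w) (hv : H v q = 1)
    (hw : H w q = 1) : qubitNbhd H q = {v, w} := by
  ext c
  simp only [qubitNbhd, Finset.mem_filter, Finset.mem_univ, true_and, Finset.mem_insert,
    Finset.mem_singleton]
  refine ⟨hG.eq_or_eq hvw hv hw, ?_⟩
  rintro (rfl | rfl) <;> assumption

variable [Fintype Q] [DecidableEq Q]

/-- Passing to the opposite endpoint is a bijection from the other qubits at `v` to the other
neighbours of `v`, and the signed minimum commutes with positive scaling. -/
theorem checkToQubit_eq (hG : IsIncidence G H) {g : ℝ} (hg : 0 < g) (s : C → ZMod 2)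
    {ν : Q → C → ℝ} {x : C → C → ℝ}
    (hν : ∀ q v w, v ≠ w → H v q = 1 → H w q = 1 → ν q w = g * x v w)
    {q : Q} {v w : C} (hvw : v ≠ w) (hv : H v q = 1) (hw : H w q = 1) :
    checkToQubit H s ν v q =
      g * ((if s v = 1 then -1 else 1) * signedMin (otherNbrs G v w) fun u => x u v) := by
  -- The implication sits inside the existential so that the chosen `f` is defined on all qubits;
  -- off `v` its value is irrelevant.
  have hex : ∀ q', ∃ u, H v q' = 1 → u ≠ v ∧ H u q' = 1 := fun q' => by
    by_cases h : H v q' = 1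
    · obtain ⟨u, hu⟩ := hG.exists_other h
      exact ⟨u, fun _ => hu⟩
    · exact ⟨v, fun h' => absurd h' h⟩
  choose f hf using hex
  have himg : otherNbrs G v w = ((checkNbhd H v).erase q).image f := by
    ext u
    simp only [mem_otherNbrs, Finset.mem_image, Finset.mem_erase, checkNbhd, Finset.mem_filter,
      Finset.mem_univ, true_and]
    constructor
    · rintro ⟨hadj, huw⟩
      obtain ⟨hvu, q', hvq, huq⟩ := (hG.adj v u).1 hadj
      refine ⟨q', ⟨?_, hvq⟩, ?_⟩
      · rintro rfl
        rcases hG.eq_or_eq hvw hv hw huq with h | h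
        · exact hvu h.symm
        · exact huw h
      · rcases hG.eq_or_eq hvu hvq huq (hf q' hvq).2 with h | h
        · exact absurd h (hf q' hvq).1
        · exact h
    · rintro ⟨q', ⟨hne, hvq⟩, rfl⟩
      obtain ⟨h1, h2⟩ := hf q' hvq
      refine ⟨(hG.adj _ _).2 ⟨h1.symm, q', hvq, h2⟩, fun h => hne ?_⟩
      rw [h] at h2
      exact hG.unique v w q' q hvw hvq h2 hv hw
  have hinj : Set.InjOn f ((checkNbhd H v).erase q : Finset Q) := by
    intro q₁ h₁ q₂ h₂ h
    simp only [Finset.coe_erase, checkNbhd, Finset.coe_filter, Finset.mem_univ, true_and,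
      Set.mem_sdiff, Set.mem_ofPred_eq] at h₁ h₂
    obtain ⟨a, b⟩ := hf q₁ h₁.1
    obtain ⟨-, d⟩ := hf q₂ h₂.1
    rw [← h] at d
    exact hG.unique v (f q₁) q₁ q₂ a.symm h₁.1 b h₂.1 d
  have hcq : checkToQubit H s ν v q =
      (if s v = 1 then -1 else 1) * signedMin ((checkNbhd H v).erase q) (fun q' => ν q' v) := by
    unfold checkToQubit signedMin
    split_ifs <;> simp
  have hval : signedMin ((checkNbhd H v).erase q) (fun q' => ν q' v) =
      signedMin ((checkNbhd H v).erase q) (fun q' => g * ((fun u => x u v) ∘ f) q') := by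
    refine signedMin_congr fun q' hq' => ?_
    simp only [Finset.mem_erase, checkNbhd, Finset.mem_filter, Finset.mem_univ, true_and] at hq'
    obtain ⟨h1, h2⟩ := hf q' hq'.2
    exact hν q' _ v h1 h2 hq'.2
  rw [hcq, hval, signedMin_const_mul hg, ← signedMin_image hinj, ← himg]
  ring

theorem qubitToCheck_eq (hG : IsIncidence G H) {g : ℝ} (hg : 0 < g) (s : C → ZMod 2) (i : ℕ) :
    ∀ q v w, v ≠ w → H v q = 1 → H w q = 1 →
      qubitToCheck H (fun _ => g) s i q w = g * edgeMsg G s i v w := by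
  induction i with
  | zero => intros; simp [qubitToCheck, edgeMsg]
  | succ i ih =>
    intro q v w hvw hv hw
    have : (qubitNbhd H q).erase w = {v} := by
      rw [hG.qubitNbhd_eq hvw hv hw]
      ext c
      simp only [Finset.mem_erase, Finset.mem_insert, Finset.mem_singleton]
      grind
    simp only [qubitToCheck]
    rw [this, Finset.sum_singleton, hG.checkToQubit_eq hg s ih hvw hv hw, edgeMsg_succ]
    ring

/-- Each directed message already contains the prior, so the sum counts it twice; the formula is
also right at iteration 0. -/
theorem minSumApp_eq (hG : IsIncidence G H) {g : ℝ} (hg : 0 < g) (s : C → ZMod 2) (i : ℕ)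
    {q : Q} {v w : C} (hvw : v ≠ w) (hv : H v q = 1) (hw : H w q = 1) :
    minSumApp H (fun _ => g) s q i = g * (edgeMsg G s i v w + edgeMsg G s i w v - 1) := by
  cases i with
  | zero => simp [minSumApp, edgeMsg]
  | succ i =>
    rw [minSumApp, hG.qubitNbhd_eq hvw hv hw, Finset.sum_pair hvw,
      hG.checkToQubit_eq hg s (hG.qubitToCheck_eq hg s i) hvw hv hw,
      hG.checkToQubit_eq hg s (hG.qubitToCheck_eq hg s i) hvw.symm hw hv, edgeMsg_succ,
      edgeMsg_succ]
    ring

end IsIncidence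

end Transfer

/-! ### Separation of unsatisfied checks. -/

section Spacing

variable {V : Type*}

/-- The vertices with `s v = 1` are pairwise at distance at least five, expressed by the absence
of connecting paths with two, three or four edges, or a single edge. -/
structure WellSpaced (G : SimpleGraph V) (s : V → ZMod 2) : Prop where
  edge : ∀ {c c'}, s c = 1 → s c' = 1 → ¬ G.Adj c c'
  path_two : ∀ {c c' u}, s c = 1 → s c' = 1 → G.Adj c u → G.Adj c' u → c = c'
  path_three : ∀ {c c' u v}, s c = 1 → s c' = 1 → G.Adj c u → G.Adj c' v → G.Adj u v → c = c'
  path_four : ∀ {c c' u v w}, s c = 1 → s c' = 1 → G.Adj c u → G.Adj c' v → G.Adj u w →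
    G.Adj v w → c = c'

/-- `v` is unsatisfied or adjacent to an unsatisfied check. -/
def NearUnsat (G : SimpleGraph V) (s : V → ZMod 2) (v : V) : Prop :=
  s v = 1 ∨ ∃ c, s c = 1 ∧ G.Adj c v

/-- An unsatisfied check at or next to `u` would be within three steps of `c`, hence equal to `c`.
-/
theorem not_nearUnsat {G : SimpleGraph V} {s : V → ZMod 2} (hs : WellSpaced G s) {c w u : V}
    (hc : s c = 1) (hw : G.Adj c w) (hu : G.Adj w u) (huc : u ≠ c) (hcu : ¬ G.Adj c u) :
    ¬ NearUnsat G s u := by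
  rintro (h | ⟨c', h, hcu'⟩)
  · exact huc (hs.path_two h hc hu.symm hw)
  · exact hcu (hs.path_three hc h hw hcu' hu ▸ hcu')

end Spacing

/-! ### Both periods at least four. -/

section SquareCase

/-- Message values near an isolated unsatisfied check: out of the check, into the check, out of its
neighbours, and from the diagonal vertices into its neighbours. -/
structure SquareValues where
  out : ℤ
  back : ℤ
  fwd : ℤ
  diag : ℤ

/-- The effect of one iteration on the message values. -/
def SquareValues.step (x : SquareValues) : SquareValues :=
  ⟨1 - x.back, 1 + x.diag, 1 + x.out.sign * x.diag.sign * min |x.out| |x.diag|, 1 + x.fwd⟩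

/-- The values of the messages near an unsatisfied check after `t` iterations. -/
def squareValues : ℕ → SquareValues
  | 0 => ⟨1, 1, 1, 1⟩
  | t + 1 => (squareValues t).step

theorem squareValues_add_twelve (t : ℕ) : squareValues (t + 12) = squareValues (t + 6) := by
  induction t with
  | zero => rfl
  | succ t ih => exact congrArg SquareValues.step ih

/-- The first bound lets `fwd` decide the minimum at a diagonal vertex, the second lets `back`
decide it at the check. Periodicity leaves twelve states. -/
theorem squareValues_bound (t : ℕ) :
    |(squareValues t).fwd| ≤ (squareValues t).diag ∧ 0 ≤ (squareValues t).back := by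
  induction t using Nat.strong_induction_on with
  | _ t ih =>
    by_cases ht : t < 12
    · interval_cases t <;> decide
    · obtain ⟨u, rfl⟩ := Nat.exists_eq_add_of_le' (not_lt.1 ht)
      rw [squareValues_add_twelve]
      exact ih _ (by omega)

variable {V : Type*}

/-- `u` is joined to `c` by exactly two paths of length two, one of which passes through `w`. -/
structure IsDiagonal (G : SimpleGraph V) (c w u : V) : Prop where
  adj_left : G.Adj c w
  adj_right : G.Adj w u
  ne : u ≠ c
  other : ∃ v, v ≠ w ∧ G.Adj c v ∧ G.Adj v u ∧ ∀ y, G.Adj c y → G.Adj y u → y = w ∨ y = v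

/-- The local structure of the square lattice at `c`, when there are no triangles. -/
structure SquareAt (G : SimpleGraph V) (c : V) : Prop where
  triangle_free : ∀ v w, G.Adj c v → G.Adj c w → ¬ G.Adj v w
  exists_nbr_ne : ∀ w, ∃ v, G.Adj c v ∧ v ≠ w
  exists_diagonal : ∀ w z, G.Adj c w → ∃ u, u ≠ z ∧ IsDiagonal G c w u

variable [Fintype V] [DecidableEq V]

/-- The values of the messages near the unsatisfied checks, and a lower bound elsewhere. -/
structure SquareInvariant (G : SimpleGraph V) (s : V → ZMod 2) (X : V → V → ℝ)
    (x : SquareValues) : Prop where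
  out : ∀ c w, s c = 1 → G.Adj c w → X c w = x.out
  back : ∀ c w, s c = 1 → G.Adj c w → X w c = x.back
  fwd : ∀ c w u, s c = 1 → G.Adj c w → G.Adj w u → u ≠ c → X w u = x.fwd
  diag : ∀ c w u, s c = 1 → IsDiagonal G c w u → X u w = x.diag
  far : ∀ v w, ¬ NearUnsat G s v → G.Adj v w → x.diag ≤ X v w

theorem squareInvariant_edgeMsg {G : SimpleGraph V} {s : V → ZMod 2} (hs : WellSpaced G s)
    (hsq : ∀ c, s c = 1 → SquareAt G c) (hdeg : ∀ v w, ∃ u, G.Adj v u ∧ u ≠ w) (t : ℕ) :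
    SquareInvariant G s (edgeMsg G s t) (squareValues t) := by
  induction t with
  | zero => constructor <;> intros <;> simp [edgeMsg, squareValues]
  | succ t ih =>
    obtain ⟨hbd, hbn⟩ := squareValues_bound t
    set x := squareValues t with hx
    have hbd' : |(x.fwd : ℝ)| ≤ x.diag := by exact_mod_cast hbd
    have hE : (0 : ℝ) ≤ x.diag := (abs_nonneg _).trans hbd'
    have hB : (0 : ℝ) ≤ x.back := by exact_mod_cast hbn
    have hsucc : squareValues (t + 1) = ⟨1 - x.back, 1 + x.diag,
      1 + x.out.sign * x.diag.sign * min |x.out| |x.diag|, 1 + x.fwd⟩ := rfl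
    have far_of : ∀ c w u, s c = 1 → G.Adj c w → G.Adj w u → u ≠ c → ¬ NearUnsat G s u :=
      fun c w u hc hw hu huc => not_nearUnsat hs hc hw hu huc
        fun h => (hsq c hc).triangle_free w u hw h hu
    have sat_of : ∀ c w, s c = 1 → G.Adj c w → s w ≠ 1 := fun c w hc hw h => hs.edge hc h hw
    rw [hsucc]
    constructor
    · intro c w hc hw
      rw [edgeMsg_succ_unsat hc]
      obtain ⟨v, hv, hvw⟩ := (hsq c hc).exists_nbr_ne w
      rw [signedMin_eq_of_dominated (i := v) (by simp [hv, hvw]), ih.back c v hc hv]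
      · push_cast; ring
      · intro j hj _
        rw [mem_otherNbrs] at hj
        rw [ih.back c v hc hv, ih.back c j hc hj.1, abs_of_nonneg hB]
    · intro c w hc hw
      rw [edgeMsg_succ_sat (sat_of c w hc hw)]
      obtain ⟨u, -, hu⟩ := (hsq c hc).exists_diagonal w w hw
      rw [signedMin_eq_of_dominated (i := u) (by simp [hu.adj_right, hu.ne]), ih.diag c w u hc hu]
      · push_cast; ring
      · intro j hj _
        rw [mem_otherNbrs] at hj
        rw [ih.diag c w u hc hu, abs_of_nonneg hE]
        exact ih.far j w (far_of c w j hc hw hj.1 hj.2) hj.1.symm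
    · intro c w z hc hw hz hzc
      rw [edgeMsg_succ_sat (sat_of c w hc hw)]
      -- `w` has diagonal neighbours on both sides, so one remains after the recipient `z` is
      -- excluded.
      obtain ⟨u, huz, hu⟩ := (hsq c hc).exists_diagonal w z hw
      rw [signedMin_eq_signedMin₂ (i := c) (j := u) (by simp [hw.symm, hzc.symm])
        (by simp [hu.adj_right, huz]) hu.ne.symm, ih.diag c w u hc hu, ih.out c w hc hw,
        intCast_signedMin₂]
      · push_cast; ring
      · intro j hj hjc _
        rw [mem_otherNbrs] at hj
        rw [ih.diag c w u hc hu]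
        refine (min_le_right _ _).trans ?_
        rw [abs_of_nonneg hE]
        exact ih.far j w (far_of c w j hc hw hj.1 hjc) hj.1.symm
    · intro c w u hc hu
      have hfar := far_of c w u hc hu.adj_left hu.adj_right hu.ne
      rw [edgeMsg_succ_sat (fun h => hfar (Or.inl h))]
      obtain ⟨v, hvw, hcv, hvu, hv⟩ := hu.other
      rw [signedMin_eq_of_dominated (i := v) (by simp [hvu.symm, hvw]),
        ih.fwd c v u hc hcv hvu hu.ne]
      · push_cast; ring
      · intro j hj hjv
        rw [mem_otherNbrs] at hj
        rw [ih.fwd c v u hc hcv hvu hu.ne]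
        refine hbd'.trans (ih.far j u ?_ hj.1.symm)
        rintro (h | ⟨c', h, hcj⟩)
        · exact hfar (Or.inr ⟨j, h, hj.1.symm⟩)
        -- Distance five is used in full here: `c`, `w`, `u`, `j`, `c'` is a walk of length four.
        · obtain rfl := hs.path_four hc h hu.adj_left hcj hu.adj_right hj.1.symm
          rcases hv j hcj hj.1.symm with h | h
          · exact hj.2 h
          · exact hjv h
    · intro v w hv hvw
      rw [edgeMsg_succ_sat (fun h => hv (Or.inl h))]
      push_cast
      -- The new bound is 1 + `fwd`, exactly the new `diag`: no far message is weaker than a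
      -- diagonal one.
      refine add_le_add_right (signedMin_ge_of_eq_or_ge ?_ hbd' fun u hu => ?_) _
      · obtain ⟨u, hu⟩ := hdeg v w
        exact ⟨u, by simpa using hu⟩
      · rw [mem_otherNbrs] at hu
        by_cases hn : NearUnsat G s u
        · rcases hn with h | ⟨c, h, hcu⟩
          · exact absurd (Or.inr ⟨u, h, hu.1.symm⟩) hv
          · exact Or.inl (ih.fwd c u v h hcu hu.1.symm fun hvc => hv (Or.inl (hvc ▸ h)))
        · exact Or.inr (ih.far u v hn hu.1.symm)

end SquareCase

/-! ### One period three, the other at least five. -/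

section TriangleCase

/-- Message values near an isolated unsatisfied check on a triangle: out of the check, the lower
bound far away, into the check from a neighbour off the triangle, along the opposite edge of the
triangle, out of the triangle, and from a corner vertex to a neighbour off the triangle. -/
structure TriangleValues where
  out : ℤ
  low : ℤ
  back : ℤ
  fwd : ℤ
  side : ℤ
  turn : ℤ

/-- The effect of one iteration on the message values. -/
def TriangleValues.step (x : TriangleValues) : TriangleValues :=
  ⟨1 - x.low, 1 + x.fwd, 1 + x.turn, 1 + x.out,
    1 + x.out.sign * x.fwd.sign * min |x.out| |x.fwd|, 1 + min x.side x.low⟩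

/-- The values of the messages near an unsatisfied check after `t` iterations. -/
def triangleValues : ℕ → TriangleValues
  | 0 => ⟨1, 1, 1, 1, 1, 1⟩
  | t + 1 => (triangleValues t).step

/-- The period is six, but it starts only at state 1: states 0 and 6 differ in `back`. -/
theorem triangleValues_add_seven (t : ℕ) : triangleValues (t + 7) = triangleValues (t + 1) := by
  induction t with
  | zero => rfl
  | succ t ih => exact congrArg TriangleValues.step ih

theorem triangleValues_bound (t : ℕ) :
    |(triangleValues t).out| ≤ (triangleValues t).low ∧
    |(triangleValues t).fwd| ≤ (triangleValues t).low ∧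
    |(triangleValues t).fwd| ≤ (triangleValues t).side ∧
    ((triangleValues t).side = (triangleValues t).fwd ∨
      (triangleValues t).low ≤ (triangleValues t).side) ∧
    (triangleValues t).low ≤ (triangleValues t).back ∧ 0 ≤ (triangleValues t).turn := by
  induction t using Nat.strong_induction_on with
  | _ t ih =>
    by_cases ht : t < 7
    · interval_cases t <;> decide
    · obtain ⟨u, rfl⟩ := Nat.exists_eq_add_of_le' (not_lt.1 ht)
      rw [triangleValues_add_seven]
      exact ih _ (by omega)

variable {V : Type*}

/-- The local structure at `c` of a square lattice one of whose periods is three: `a` lists the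
other vertices of the triangle through `c`, `d` the neighbours off the triangle, `p` the common
neighbours of the `a`s and `d`s, and `e` the remaining neighbours of the `d`s. -/
structure TriangleChart (G : SimpleGraph V) (c : V) where
  a : Bool → V
  d : Bool → V
  p : Bool → Bool → V
  e : Bool → V
  adj_c : ∀ u, G.Adj c u ↔ ∃ i, u = a i ∨ u = d i
  adj_a : ∀ i u, G.Adj (a i) u ↔ u = c ∨ u = a (!i) ∨ ∃ j, u = p i j
  adj_d : ∀ j u, G.Adj (d j) u ↔ u = c ∨ u = e j ∨ ∃ i, u = p i j
  adj_pp : ∀ i j, G.Adj (p i j) (p (!i) j)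
  adj_p : ∀ i j u, G.Adj (p i j) u → u = a i ∨ u = d j ∨ u = p (!i) j ∨ ¬ G.Adj c u
  adj_e : ∀ j u, G.Adj (e j) u → u = d j ∨ ¬ G.Adj c u
  p_ne : ∀ i j, p i j ≠ c
  e_ne : ∀ j, e j ≠ c
  not_adj_p : ∀ i j, ¬ G.Adj c (p i j)
  not_adj_e : ∀ j, ¬ G.Adj c (e j)

namespace TriangleChart

variable {G : SimpleGraph V} {c : V} (K : TriangleChart G c)
include K

theorem c_a (i : Bool) : G.Adj c (K.a i) := (K.adj_c _).2 ⟨i, Or.inl rfl⟩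
theorem c_d (i : Bool) : G.Adj c (K.d i) := (K.adj_c _).2 ⟨i, Or.inr rfl⟩
theorem a_a (i : Bool) : G.Adj (K.a i) (K.a (!i)) := (K.adj_a _ _).2 (Or.inr (Or.inl rfl))
theorem a_p (i j : Bool) : G.Adj (K.a i) (K.p i j) := (K.adj_a _ _).2 (Or.inr (Or.inr ⟨j, rfl⟩))
theorem d_p (i j : Bool) : G.Adj (K.d j) (K.p i j) := (K.adj_d _ _).2 (Or.inr (Or.inr ⟨i, rfl⟩))
theorem d_e (j : Bool) : G.Adj (K.d j) (K.e j) := (K.adj_d _ _).2 (Or.inr (Or.inl rfl))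

theorem ne_p {u : V} (hu : G.Adj c u) (i j : Bool) : u ≠ K.p i j := by
  rintro rfl
  exact K.not_adj_p i j hu

/-- The minimum at `c` is decided by a triangle neighbour, so one must remain besides the recipient.
-/
theorem exists_a_ne (w : V) : ∃ i, K.a i ≠ w := by
  by_contra! h
  exact (K.a_a true).ne ((h _).trans (h _).symm)

variable {s : V → ZMod 2} (hs : WellSpaced G s) (hc : s c = 1)
include hs hc

theorem far_p (i j : Bool) : ¬ NearUnsat G s (K.p i j) :=
  not_nearUnsat hs hc (K.c_a i) (K.a_p i j) (K.p_ne i j) (K.not_adj_p i j)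

theorem far_e (j : Bool) : ¬ NearUnsat G s (K.e j) :=
  not_nearUnsat hs hc (K.c_d j) (K.d_e j) (K.e_ne j) (K.not_adj_e j)

end TriangleChart

theorem not_nearUnsat_of_path_three {G : SimpleGraph V} {s : V → ZMod 2} (hs : WellSpaced G s)
    {c w u v : V} (hc : s c = 1) (hw : G.Adj c w) (hu : G.Adj w u) (hfar : ¬ NearUnsat G s u)
    (hv : G.Adj u v) (hcv : ¬ G.Adj c v) : ¬ NearUnsat G s v := by
  rintro (h | ⟨c', h, hcj⟩)
  · exact hfar (Or.inr ⟨v, h, hv.symm⟩)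
  · exact hcv (hs.path_four hc h hw hcj hu hv.symm ▸ hcj)

variable [Fintype V] [DecidableEq V]

/-- The values of the messages near the unsatisfied checks, and a lower bound elsewhere. -/
structure TriangleInvariant (G : SimpleGraph V) (s : V → ZMod 2) (X : V → V → ℝ)
    (x : TriangleValues) : Prop where
  out : ∀ c w, s c = 1 → G.Adj c w → X c w = x.out
  back_a : ∀ c (K : TriangleChart G c) i, s c = 1 → X (K.a i) c = x.low
  back_d : ∀ c (K : TriangleChart G c) j, s c = 1 → X (K.d j) c = x.back
  across : ∀ c (K : TriangleChart G c) i, s c = 1 → X (K.a i) (K.a (!i)) = x.fwd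
  fwd : ∀ c (K : TriangleChart G c) j u, s c = 1 → G.Adj (K.d j) u → u ≠ c → X (K.d j) u = x.fwd
  side : ∀ c (K : TriangleChart G c) i j, s c = 1 → X (K.a i) (K.p i j) = x.side
  corner : ∀ c (K : TriangleChart G c) i j, s c = 1 → X (K.p i j) (K.p (!i) j) = x.low
  turn : ∀ c (K : TriangleChart G c) i j, s c = 1 → X (K.p i j) (K.d j) = x.turn
  axis : ∀ c (K : TriangleChart G c) j, s c = 1 → x.turn ≤ X (K.e j) (K.d j)
  far : ∀ v w, ¬ NearUnsat G s v → G.Adj v w → x.low ≤ X v w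

theorem triangleInvariant_edgeMsg {G : SimpleGraph V} {s : V → ZMod 2} (hs : WellSpaced G s)
    (hch : ∀ c, s c = 1 → Nonempty (TriangleChart G c)) (hdeg : ∀ v w, ∃ u, G.Adj v u ∧ u ≠ w)
    (t : ℕ) : TriangleInvariant G s (edgeMsg G s t) (triangleValues t) := by
  induction t with
  | zero => constructor <;> intros <;> simp [edgeMsg, triangleValues]
  | succ t ih =>
    obtain ⟨h1, h2, h3, h4, h5, h6⟩ := triangleValues_bound t
    have hsucc : triangleValues (t + 1) =
      ⟨1 - (triangleValues t).low, 1 + (triangleValues t).fwd, 1 + (triangleValues t).turn,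
        1 + (triangleValues t).out,
        1 + (triangleValues t).out.sign * (triangleValues t).fwd.sign *
          min |(triangleValues t).out| |(triangleValues t).fwd|,
        1 + min (triangleValues t).side (triangleValues t).low⟩ := rfl
    rw [hsucc]
    clear hsucc
    set x := triangleValues t
    replace h1 : |(x.out : ℝ)| ≤ x.low := by exact_mod_cast h1
    replace h2 : |(x.fwd : ℝ)| ≤ x.low := by exact_mod_cast h2
    replace h3 : |(x.fwd : ℝ)| ≤ x.side := by exact_mod_cast h3
    replace h4 : (x.side : ℝ) = x.fwd ∨ (x.low : ℝ) ≤ x.side := by exact_mod_cast h4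
    replace h5 : (x.low : ℝ) ≤ x.back := by exact_mod_cast h5
    replace h6 : (0 : ℝ) ≤ x.turn := by exact_mod_cast h6
    have hE : (0 : ℝ) ≤ x.low := (abs_nonneg _).trans h1
    have hG : (0 : ℝ) ≤ x.side := (abs_nonneg _).trans h3
    have sat_of : ∀ {c w}, s c = 1 → G.Adj c w → s w ≠ 1 := fun hc hw h => hs.edge hc h hw
    have far_ne : ∀ {v}, ¬ NearUnsat G s v → s v ≠ 1 := fun h h' => h (Or.inl h')
    have low_p : ∀ {c} (K : TriangleChart G c) i j u, s c = 1 → G.Adj (K.p i j) u →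
        (x.low : ℝ) ≤ edgeMsg G s t (K.p i j) u := fun K i j u hc h =>
      ih.far _ _ (K.far_p hs hc i j) h
    have low_e : ∀ {c} (K : TriangleChart G c) j u, s c = 1 → G.Adj (K.e j) u →
        (x.low : ℝ) ≤ edgeMsg G s t (K.e j) u := fun K j u hc h =>
      ih.far _ _ (K.far_e hs hc j) h
    constructor
    · intro c w hc hw
      obtain ⟨K⟩ := hch c hc
      obtain ⟨i, hi⟩ := K.exists_a_ne w
      rw [edgeMsg_succ_unsat hc, signedMin_eq_of_dominated (i := K.a i) (by simp [K.c_a, hi]),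
        ih.back_a c K i hc]
      · push_cast; ring
      · intro v hv _
        rw [mem_otherNbrs, K.adj_c] at hv
        rw [ih.back_a c K i hc, abs_of_nonneg hE]
        obtain ⟨⟨k, rfl | rfl⟩, -⟩ := hv
        · rw [ih.back_a c K k hc]
        · rwa [ih.back_d c K k hc]
    · intro c K i hc
      have hacross : edgeMsg G s t (K.a (!i)) (K.a i) = x.fwd := by
        simpa using ih.across c K (!i) hc
      rw [edgeMsg_succ_sat (sat_of hc (K.c_a i)), signedMin_eq_of_dominated (i := K.a (!i))
        (by simp [K.a_a, (K.c_a _).ne']), hacross]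
      · push_cast; ring
      · intro v hv hva
        rw [mem_otherNbrs, K.adj_a] at hv
        obtain ⟨rfl | rfl | ⟨j, rfl⟩, hvc⟩ := hv
        · exact absurd rfl hvc
        · exact absurd rfl hva
        · rw [hacross]
          exact h2.trans (low_p K i j _ hc (K.a_p i j).symm)
    · intro c K j hc
      -- Either corner would do, both sending `turn`; the message from `e` is at least that, so its
      -- exact value is not needed.
      rw [edgeMsg_succ_sat (sat_of hc (K.c_d j)), signedMin_eq_of_dominated (i := K.p true j)
        (by simp [K.d_p, K.p_ne]), ih.turn c K true j hc]
      · push_cast; ring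
      · intro v hv _
        rw [mem_otherNbrs, K.adj_d] at hv
        rw [ih.turn c K true j hc, abs_of_nonneg h6]
        obtain ⟨rfl | rfl | ⟨i, rfl⟩, hvc⟩ := hv
        · exact absurd rfl hvc
        · exact ih.axis c K j hc
        · exact (ih.turn c K i j hc).ge
    · intro c K i hc
      rw [edgeMsg_succ_sat (sat_of hc (K.c_a i)), signedMin_eq_of_dominated (i := c)
        (by simp [(K.c_a _).symm, (K.c_a _).ne]), ih.out c _ hc (K.c_a i)]
      · push_cast; ring
      · intro v hv hvc
        rw [mem_otherNbrs, K.adj_a] at hv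
        obtain ⟨rfl | rfl | ⟨j, rfl⟩, hva⟩ := hv
        · exact absurd rfl hvc
        · exact absurd rfl hva
        · rw [ih.out c _ hc (K.c_a i)]
          exact h1.trans (low_p K i j _ hc (K.a_p i j).symm)
    · intro c K j u hc hu huc
      rw [edgeMsg_succ_sat (sat_of hc (K.c_d j)), signedMin_eq_of_dominated (i := c)
        (by simp [(K.c_d _).symm, huc.symm]), ih.out c _ hc (K.c_d j)]
      · push_cast; ring
      · intro v hv hvc
        rw [mem_otherNbrs, K.adj_d] at hv
        rw [ih.out c _ hc (K.c_d j)]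
        obtain ⟨rfl | rfl | ⟨i, rfl⟩, -⟩ := hv
        · exact absurd rfl hvc
        · exact h1.trans (low_e K j _ hc (K.d_e j).symm)
        · exact h1.trans (low_p K i j _ hc (K.d_p i j).symm)
    · intro c K i j hc
      have hacross : edgeMsg G s t (K.a (!i)) (K.a i) = x.fwd := by
        simpa using ih.across c K (!i) hc
      rw [edgeMsg_succ_sat (sat_of hc (K.c_a i)), signedMin_eq_signedMin₂ (i := c) (j := K.a (!i))
        (by simp [(K.c_a _).symm, (K.p_ne _ _).symm]) (by simp [K.a_a, K.ne_p (K.c_a _)])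
        (K.c_a _).ne, ih.out c _ hc (K.c_a i), hacross, intCast_signedMin₂]
      · push_cast; ring
      · intro v hv hvc hva
        rw [mem_otherNbrs, K.adj_a] at hv
        obtain ⟨rfl | rfl | ⟨k, rfl⟩, -⟩ := hv
        · exact absurd rfl hvc
        · exact absurd rfl hva
        · rw [hacross]
          exact ((min_le_right _ _).trans h2).trans (low_p K i k _ hc (K.a_p i k).symm)
    · intro c K i j hc
      have hfar := K.far_p hs hc i j
      have hd : edgeMsg G s t (K.d j) (K.p i j) = x.fwd :=
        ih.fwd c K j _ hc (K.d_p i j) (K.p_ne i j)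
      rw [edgeMsg_succ_sat (far_ne hfar), signedMin_eq_of_dominated (i := K.d j)
        (by simp [(K.d_p _ _).symm, K.ne_p (K.c_d _)]), hd]
      · push_cast; ring
      · intro v hv hvd
        rw [mem_otherNbrs] at hv
        rw [hd]
        rcases K.adj_p i j v hv.1 with rfl | rfl | rfl | h
        · rwa [ih.side c K i j hc]
        · exact absurd rfl hvd
        · exact absurd rfl hv.2
        · exact h2.trans (ih.far _ _ (not_nearUnsat_of_path_three hs hc (K.c_a i) (K.a_p i j) hfar
            hv.1 h) hv.1.symm)
    · intro c K i j hc
      have hfar := K.far_p hs hc i j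
      have hp : edgeMsg G s t (K.p (!i) j) (K.p i j) = x.low := by
        simpa using ih.corner c K (!i) j hc
      have ha := ih.side c K i j hc
      have hpd : K.p (!i) j ≠ K.d j := (K.ne_p (K.c_d j) _ _).symm
      have had : K.a i ≠ K.d j := fun h => by
        have := (K.adj_d j _).1 (h ▸ K.a_a i)
        rcases this with h' | h' | ⟨k, h'⟩
        · exact (K.c_a _).ne' h'
        · exact K.not_adj_e j (h' ▸ K.c_a _)
        · exact K.not_adj_p k j (h' ▸ K.c_a _)
      rw [edgeMsg_succ_sat (far_ne hfar)]
      have hmin : ∀ v ∈ otherNbrs G (K.p i j) (K.d j),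
          (min x.side x.low : ℝ) ≤ edgeMsg G s t v (K.p i j) := by
        intro v hv
        rw [mem_otherNbrs] at hv
        rcases K.adj_p i j v hv.1 with rfl | rfl | rfl | h
        · rw [ha]; exact min_le_left _ _
        · exact absurd rfl hv.2
        · rw [hp]; exact min_le_right _ _
        · exact (min_le_right _ _).trans (ih.far _ _ (not_nearUnsat_of_path_three hs hc (K.c_a i)
            (K.a_p i j) hfar hv.1 h) hv.1.symm)
      push_cast
      congr 1
      -- All entries are nonnegative, so the smaller of `side` and `low` decides the minimum.
      rcases le_total (x.side : ℝ) x.low with h | h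
      · rw [min_eq_left h] at hmin ⊢
        rw [signedMin_eq_of_dominated (i := K.a i) (by simp [(K.a_p _ _).symm, had]), ha]
        intro v hv _
        rw [ha, abs_of_nonneg hG]
        exact hmin v hv
      · rw [min_eq_right h] at hmin ⊢
        rw [signedMin_eq_of_dominated (i := K.p (!i) j) (by simp [K.adj_pp, hpd]), hp]
        intro v hv _
        rw [hp, abs_of_nonneg hE]
        exact hmin v hv
    · intro c K j hc
      have hfar := K.far_e hs hc j
      rw [edgeMsg_succ_sat (far_ne hfar)]
      push_cast
      refine add_le_add_right ((min_le_right _ _).trans (le_signedMin ?_ hE fun v hv => ?_)) _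
      · obtain ⟨u, hu⟩ := hdeg (K.e j) (K.d j)
        exact ⟨u, by simpa using hu⟩
      · rw [mem_otherNbrs] at hv
        exact ih.far _ _ (not_nearUnsat_of_path_three hs hc (K.c_d j) (K.d_e j) hfar hv.1
          ((K.adj_e j v hv.1).resolve_left hv.2)) hv.1.symm
    · intro v w hv hvw
      rw [edgeMsg_succ_sat (far_ne hv)]
      push_cast
      refine add_le_add_right (signedMin_ge_of_eq_or_ge ?_ h2 fun u hu => ?_) _
      · obtain ⟨u, hu⟩ := hdeg v w
        exact ⟨u, by simpa using hu⟩
      · rw [mem_otherNbrs] at hu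
        by_cases hn : NearUnsat G s u
        · rcases hn with h | ⟨c, h, hcu⟩
          · exact absurd (Or.inr ⟨u, h, hu.1.symm⟩) hv
          · obtain ⟨K⟩ := hch c h
            have hvc : v ≠ c := fun hvc => hv (Or.inl (hvc ▸ h))
            obtain ⟨i, rfl | rfl⟩ := (K.adj_c u).1 hcu
            · rcases (K.adj_a i v).1 hu.1.symm with rfl | rfl | ⟨j, rfl⟩
              · exact absurd rfl hvc
              · exact absurd (Or.inr ⟨c, h, K.c_a _⟩) hv
              -- A `side` message either equals `fwd` or already meets the far bound.
              · rw [ih.side c K i j h]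
                exact h4
            · exact Or.inl (ih.fwd c K i v h hu.1.symm hvc)
        · exact Or.inr (ih.far u v hn hu.1.symm)

end TriangleCase

/-! ### Local geometry of the toric lattice. -/

section Toric

theorem wellSpaced_of_dist {V : Type*} {G : SimpleGraph V} {s : V → ZMod 2}
    (h : ∀ c c', s c = 1 → s c' = 1 → c ≠ c' → 5 ≤ G.dist c c') : WellSpaced G s := by
  have key : ∀ {c c'} (p : G.Walk c c'), p.length ≤ 4 → s c = 1 → s c' = 1 → c = c' := by
    intro c c' p hp hc hc'
    by_contra hne
    have := (h c c' hc hc' hne).trans (G.dist_le p)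
    omega
  refine ⟨fun hc hc' hadj => ?_, fun hc hc' h₁ h₂ => ?_, fun hc hc' h₁ h₂ h₃ => ?_,
    fun hc hc' h₁ h₂ h₃ h₄ => ?_⟩
  · exact hadj.ne (key (.cons hadj .nil) (by simp) hc hc')
  · exact key (.cons h₁ (.cons h₂.symm .nil)) (by simp) hc hc'
  · exact key (.cons h₁ (.cons h₃ (.cons h₂.symm .nil))) (by simp) hc hc'
  · exact key (.cons h₁ (.cons h₃ (.cons h₄.symm (.cons h₂.symm .nil)))) (by simp) hc hc'

theorem wellSpaced_fakeSyndrome {V : Type*} [DecidableEq V] (G : SimpleGraph V) (c : V) :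
    WellSpaced G (fakeSyndrome c) :=
  wellSpaced_of_dist fun v w hv hw hne => by
    simp only [fakeSyndrome, ite_eq_left_iff, zero_ne_one, imp_false, not_not] at hv hw
    exact absurd (hv.trans hw.symm) hne

theorem natCast_zmod_ne_zero {m k : ℕ} (hk : k ≠ 0) (hm : k < m) : (k : ZMod m) ≠ 0 := by
  rw [Ne, ZMod.natCast_eq_zero_iff]
  exact Nat.not_dvd_of_pos_of_lt (Nat.pos_of_ne_zero hk) hm

variable {m n : ℕ}

theorem toricH_eq_one {c : ToricCheck m n} {q : ToricQubit m n} :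
    toricH m n c q = 1 ↔ c = q.1 ∨ c = toricTarget q := by
  simp only [toricH, ite_eq_left_iff, zero_ne_one, imp_false, not_not]

/-- Periods at least three exclude loops (1 ≠ 0) and double edges (2 ≠ 0). -/
theorem isIncidence_toric (hm : 3 ≤ m) (hn : 3 ≤ n) :
    IsIncidence (toricLattice m n) (toricH m n) := by
  have h1 : (1 : ZMod m) ≠ 0 := by exact_mod_cast natCast_zmod_ne_zero one_ne_zero (by omega)
  have h2 : (2 : ZMod m) ≠ 0 := by exact_mod_cast natCast_zmod_ne_zero two_ne_zero (by omega)
  have h1' : (1 : ZMod n) ≠ 0 := by exact_mod_cast natCast_zmod_ne_zero one_ne_zero (by omega)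
  have h2' : (2 : ZMod n) ≠ 0 := by exact_mod_cast natCast_zmod_ne_zero two_ne_zero (by omega)
  refine ⟨fun q => ⟨q.1, toricTarget q, ?_, fun c => toricH_eq_one⟩, ?_, fun v w => Iff.rfl⟩
  · obtain ⟨⟨x, y⟩, b⟩ := q
    cases b <;> simp [toricTarget, h1, h1']
  · rintro ⟨x, y⟩ ⟨x', y'⟩ ⟨⟨a, b⟩, i⟩ ⟨⟨a', b'⟩, j⟩ hne hv hw hv' hw'
    rw [toricH_eq_one] at hv hw hv' hw'
    cases i <;> cases j <;>
      simp only [toricTarget, Prod.mk.injEq, Prod.mk_add_mk, add_zero, ne_eq, if_true,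
        Bool.false_eq_true, if_false] at * <;> grind

theorem toricLattice_adj (hm : 3 ≤ m) (hn : 3 ≤ n) (x x' : ZMod m) (y y' : ZMod n) :
    (toricLattice m n).Adj (x, y) (x', y') ↔
      (y' = y ∧ (x' = x + 1 ∨ x = x' + 1)) ∨ (x' = x ∧ (y' = y + 1 ∨ y = y' + 1)) := by
  have h1 : (1 : ZMod m) ≠ 0 := by exact_mod_cast natCast_zmod_ne_zero one_ne_zero (by omega)
  have h1' : (1 : ZMod n) ≠ 0 := by exact_mod_cast natCast_zmod_ne_zero one_ne_zero (by omega)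
  rw [(isIncidence_toric hm hn).adj]
  constructor
  · rintro ⟨hne, ⟨⟨a, b⟩, i⟩, hv, hw⟩
    rw [toricH_eq_one] at hv hw
    cases i <;>
      simp only [toricTarget, Prod.mk.injEq, Prod.mk_add_mk, add_zero, ne_eq, if_true,
        Bool.false_eq_true, if_false] at * <;> grind
  · rintro (⟨rfl, rfl | rfl⟩ | ⟨rfl, rfl | rfl⟩)
    · exact ⟨by simp [h1], ((x, y'), false), by simp [toricH_eq_one, toricTarget]⟩
    · exact ⟨by simp [h1], ((x', y'), false), by simp [toricH_eq_one, toricTarget]⟩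
    · exact ⟨by simp [h1'], ((x', y), true), by simp [toricH_eq_one, toricTarget]⟩
    · exact ⟨by simp [h1'], ((x', y'), true), by simp [toricH_eq_one, toricTarget]⟩

theorem toricLattice_exists_nbr_ne (hm : 3 ≤ m) (hn : 3 ≤ n) (v w : ToricCheck m n) :
    ∃ u, (toricLattice m n).Adj v u ∧ u ≠ w := by
  have h1 : (1 : ZMod m) ≠ 0 := by exact_mod_cast natCast_zmod_ne_zero one_ne_zero (by omega)
  obtain ⟨x, y⟩ := v
  by_cases hw : w = (x + 1, y)
  · refine ⟨(x, y + 1), by simp [toricLattice_adj hm hn], ?_⟩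
    rw [hw]
    simp [h1]
  · exact ⟨(x + 1, y), by simp [toricLattice_adj hm hn], Ne.symm hw⟩

/-- Here 3 ≠ 0 excludes triangles, and 2 ≠ 0 excludes further common neighbours of opposite corners
of a unit square. -/
theorem squareAt_toricLattice (hm : 4 ≤ m) (hn : 4 ≤ n) (c : ToricCheck m n) :
    SquareAt (toricLattice m n) c := by
  have h1 : (1 : ZMod m) ≠ 0 := by exact_mod_cast natCast_zmod_ne_zero one_ne_zero (by omega)
  have h2 : (2 : ZMod m) ≠ 0 := by exact_mod_cast natCast_zmod_ne_zero two_ne_zero (by omega)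
  have h3 : (3 : ZMod m) ≠ 0 := by exact_mod_cast natCast_zmod_ne_zero three_ne_zero (by omega)
  have h1' : (1 : ZMod n) ≠ 0 := by exact_mod_cast natCast_zmod_ne_zero one_ne_zero (by omega)
  have h2' : (2 : ZMod n) ≠ 0 := by exact_mod_cast natCast_zmod_ne_zero two_ne_zero (by omega)
  have h3' : (3 : ZMod n) ≠ 0 := by exact_mod_cast natCast_zmod_ne_zero three_ne_zero (by omega)
  have hadj := toricLattice_adj (m := m) (n := n) (by omega) (by omega)
  have hdiag : ∀ (x x' : ZMod m) (y y' : ZMod n), (x' = x + 1 ∨ x = x' + 1) →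
      (y' = y + 1 ∨ y = y' + 1) → IsDiagonal (toricLattice m n) (x, y) (x', y) (x', y') ∧
        IsDiagonal (toricLattice m n) (x, y) (x, y') (x', y') := by
    intro x x' y y' hx hy
    constructor
    · refine ⟨by simp only [hadj]; grind, by simp only [hadj]; grind, by grind,
        ⟨(x, y'), by grind, by simp only [hadj]; grind, by simp only [hadj]; grind, ?_⟩⟩
      rintro ⟨a, b⟩ h h'
      simp only [hadj] at h h'
      grind
    · refine ⟨by simp only [hadj]; grind, by simp only [hadj]; grind, by grind,
        ⟨(x', y), by grind, by simp only [hadj]; grind, by simp only [hadj]; grind, ?_⟩⟩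
      rintro ⟨a, b⟩ h h'
      simp only [hadj] at h h'
      grind
  obtain ⟨x, y⟩ := c
  refine ⟨?_, toricLattice_exists_nbr_ne (by omega) (by omega) (x, y), ?_⟩
  · rintro ⟨a, b⟩ ⟨a', b'⟩ h h'
    simp only [hadj] at h h' ⊢
    grind
  · rintro ⟨a, b⟩ z h
    rw [hadj] at h
    rcases h with ⟨rfl, h⟩ | ⟨rfl, h⟩
    · by_cases hz : z = (a, b + 1)
      · exact ⟨(a, b - 1), by
          rw [hz, Ne, Prod.mk.injEq]
          exact fun h => h2' (by linear_combination -h.2), (hdiag _ _ _ _ h (Or.inr (by ring))).1⟩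
      · exact ⟨(a, b + 1), Ne.symm hz, (hdiag _ _ _ _ h (Or.inl rfl)).1⟩
    · by_cases hz : z = (a + 1, b)
      · exact ⟨(a - 1, b), by
          rw [hz, Ne, Prod.mk.injEq]
          exact fun h => h2 (by linear_combination -h.1), (hdiag _ _ _ _ (Or.inr (by ring)) h).2⟩
      · exact ⟨(a + 1, b), Ne.symm hz, (hdiag _ _ _ _ (Or.inl rfl) h).2⟩

/-- The equivalence `φ` lets either coordinate be the one of period three. If `4 * v` vanished, the
two vertices `e` would coincide and be adjacent to both vertices `d`. -/
theorem nonempty_triangleChart_of_adj {R S : Type*} [CommRing R] [CommRing S] {u : R} {v : S}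
    {V : Type*} {G : SimpleGraph V} (φ : R × S ≃ V)
    (hadj : ∀ x x' y y', G.Adj (φ (x, y)) (φ (x', y')) ↔
      (y' = y ∧ (x' = x + u ∨ x = x' + u)) ∨ (x' = x ∧ (y' = y + v ∨ y = y' + v)))
    (h1 : u ≠ 0) (h3 : 3 * u = 0) (h1' : v ≠ 0) (h2' : 2 * v ≠ 0)
    (h3' : 3 * v ≠ 0) (h4' : 4 * v ≠ 0) (c : V) : Nonempty (TriangleChart G c) := by
  obtain ⟨⟨x, y⟩, rfl⟩ := φ.surjective c
  have h2 : 2 * u ≠ 0 := fun h => h1 (by linear_combination h3 - h)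
  -- Around a triangle, two steps in one direction are one step in the other.
  have e₁ : ∀ a, x - u = a + u ↔ a = x + u := fun a =>
    ⟨fun h => by linear_combination -h - h3, fun h => by linear_combination -h - h3⟩
  have e₂ : ∀ a, a = x + u + u ↔ a = x - u := fun a =>
    ⟨fun h => by linear_combination h + h3, fun h => by linear_combination h - h3⟩
  refine ⟨⟨fun i => φ (cond i (x + u) (x - u), y), fun j => φ (x, cond j (y + v) (y - v)),
    fun i j => φ (cond i (x + u) (x - u), cond j (y + v) (y - v)),
    fun j => φ (x, cond j (y + 2 * v) (y - 2 * v)), ?_, ?_, ?_, ?_, ?_, ?_, ?_, ?_, ?_, ?_⟩⟩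
  all_goals simp only [φ.surjective.forall, φ.injective.eq_iff, Prod.forall, hadj, e₁, e₂,
    Bool.forall_bool, Bool.exists_bool, cond_true, cond_false, Bool.not_true, Bool.not_false, Prod.mk.injEq, ne_eq]
  all_goals clear hadj
  all_goals grind

theorem nonempty_triangleChart_toricLattice (hmn : m = 3 ∧ 5 ≤ n ∨ 5 ≤ m ∧ n = 3)
    (c : ToricCheck m n) : Nonempty (TriangleChart (toricLattice m n) c) := by
  have hadj := toricLattice_adj (m := m) (n := n) (by omega) (by omega)
  have key : ∀ {k : ℕ}, 5 ≤ k → (1 : ZMod k) ≠ 0 ∧ (2 * 1 : ZMod k) ≠ 0 ∧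
      (3 * 1 : ZMod k) ≠ 0 ∧ (4 * 1 : ZMod k) ≠ 0 := fun {k} hk => by
    refine ⟨?_, ?_, ?_, ?_⟩
    · exact_mod_cast natCast_zmod_ne_zero (m := k) one_ne_zero (by omega)
    · simpa using natCast_zmod_ne_zero (m := k) two_ne_zero (by omega)
    · simpa using natCast_zmod_ne_zero (m := k) three_ne_zero (by omega)
    · simpa using natCast_zmod_ne_zero (m := k) four_ne_zero (by omega)
  rcases hmn with ⟨rfl, hn⟩ | ⟨hm, rfl⟩
  · obtain ⟨h1, h2, h3, h4⟩ := key hn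
    exact nonempty_triangleChart_of_adj (Equiv.refl _) hadj (by decide) (by decide) h1 h2 h3 h4 c
  · obtain ⟨h1, h2, h3, h4⟩ := key hm
    exact nonempty_triangleChart_of_adj (Equiv.prodComm _ _)
      (fun x x' y y' => (hadj y y' x x').trans or_comm) (by decide) (by decide) h1 h2 h3 h4 c

end Toric

/-! ### Small tori and conclusion. -/

section Main

variable {m n : ℕ}

/-- A cycle of length three or four has diameter at most two; one such walk per coordinate bounds
the diameter of a small torus by four. -/
theorem exists_walk_length_le_two {k : ℕ} (hk : 3 ≤ k) (hk' : k ≤ 4) {V : Type*}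
    {G : SimpleGraph V} (f : ZMod k → V) (hf : ∀ x, G.Adj (f x) (f (x + 1))) (x x' : ZMod k) :
    ∃ p : G.Walk (f x) (f x'), p.length ≤ 2 := by
  have h : x' = x ∨ x' = x + 1 ∨ x = x' + 1 ∨ x' = x + 1 + 1 := by
    obtain rfl | rfl : k = 3 ∨ k = 4 := by omega
    · revert x x'; decide
    · revert x x'; decide
  rcases h with rfl | rfl | rfl | rfl
  · exact ⟨.nil, by simp⟩
  · exact ⟨.cons (hf _) .nil, by simp⟩
  · exact ⟨.cons (hf _).symm .nil, by simp⟩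
  · exact ⟨.cons (hf _) (.cons (hf _) .nil), by simp⟩

theorem toricLattice_dist_le_four (hm : 3 ≤ m) (hn : 3 ≤ n) (hm' : m ≤ 4) (hn' : n ≤ 4)
    (c c' : ToricCheck m n) : (toricLattice m n).dist c c' ≤ 4 := by
  obtain ⟨x, y⟩ := c
  obtain ⟨x', y'⟩ := c'
  obtain ⟨p, hp⟩ := exists_walk_length_le_two hm hm' (G := toricLattice m n) (fun x => (x, y))
    (fun x => by simp [toricLattice_adj hm hn]) x x'
  obtain ⟨r, hr⟩ := exists_walk_length_le_two hn hn' (G := toricLattice m n) (fun y => (x', y))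
    (fun y => by simp [toricLattice_adj hm hn]) y y'
  refine ((toricLattice m n).dist_le (p.append r)).trans ?_
  rw [SimpleGraph.Walk.length_append]
  omega

/-- The messages on the edges at an unsatisfied check do not depend on the other, distant ones. -/
theorem edgeMsg_eq_of_wellSpaced [NeZero m] [NeZero n] (hm : 3 ≤ m) (hn : 3 ≤ n)
    (hlarge : 5 ≤ m ∨ 5 ≤ n ∨ (4 ≤ m ∧ 4 ≤ n)) {s s' : ToricCheck m n → ZMod 2}
    (hs : WellSpaced (toricLattice m n) s) (hs' : WellSpaced (toricLattice m n) s')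
    {c w : ToricCheck m n} (hc : s c = 1) (hc' : s' c = 1) (hw : (toricLattice m n).Adj c w)
    (t : ℕ) :
    edgeMsg (toricLattice m n) s t c w = edgeMsg (toricLattice m n) s' t c w ∧
      edgeMsg (toricLattice m n) s t w c = edgeMsg (toricLattice m n) s' t w c := by
  have hdeg := toricLattice_exists_nbr_ne hm hn
  by_cases hsq : 4 ≤ m ∧ 4 ≤ n
  · have hat := squareAt_toricLattice hsq.1 hsq.2
    have h := squareInvariant_edgeMsg hs (fun c _ => hat c) hdeg t
    have h' := squareInvariant_edgeMsg hs' (fun c _ => hat c) hdeg t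
    exact ⟨(h.out c w hc hw).trans (h'.out c w hc' hw).symm,
      (h.back c w hc hw).trans (h'.back c w hc' hw).symm⟩
  -- Since 3 × 3, 3 × 4 and 4 × 3 are excluded by `hlarge`, one period is 3 and the other at least
  -- 5.
  · have hat := nonempty_triangleChart_toricLattice (m := m) (n := n) (by omega)
    have h := triangleInvariant_edgeMsg hs (fun c _ => hat c) hdeg t
    have h' := triangleInvariant_edgeMsg hs' (fun c _ => hat c) hdeg t
    refine ⟨(h.out c w hc hw).trans (h'.out c w hc' hw).symm, ?_⟩
    obtain ⟨K⟩ := hat c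
    obtain ⟨i, rfl | rfl⟩ := (K.adj_c w).1 hw
    · exact (h.back_a c K i hc).trans (h'.back_a c K i hc').symm
    · exact (h.back_d c K i hc).trans (h'.back_d c K i hc').symm

end Main

theorem theorem1 (m n : ℕ) [NeZero m] [NeZero n] (hm : 3 ≤ m) (hn : 3 ≤ n)
    (p : ℝ) (hp0 : 0 < p) (hp : p < 1 / 2)
    (e : ToricQubit m n → ZMod 2) (s : ToricCheck m n → ZMod 2)
    (hs : s = (toricH m n).mulVec e)
    (hdist : ∀ c c' : ToricCheck m n, s c = 1 → s c' = 1 → c ≠ c' →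
      5 ≤ (toricLattice m n).dist c c')
    (c : ToricCheck m n) (hc : s c = 1) :
    MinSumLocallyBlind (toricH m n) (iidPrior p) s c := by
  intro q hq i
  by_cases hlarge : 5 ≤ m ∨ 5 ≤ n ∨ (4 ≤ m ∧ 4 ≤ n)
  · have hinc := isIncidence_toric hm hn
    have hg : 0 < Real.log ((1 - p) / p) :=
      Real.log_pos ((one_lt_div hp0).2 (by linarith))
    have hcq : toricH m n c q = 1 := by simpa [checkNbhd] using hq
    obtain ⟨w, hwc, hwq⟩ := hinc.exists_other hcq
    obtain ⟨h₁, h₂⟩ := edgeMsg_eq_of_wellSpaced hm hn hlarge (wellSpaced_of_dist hdist)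
      (wellSpaced_fakeSyndrome (toricLattice m n) c) hc (by simp [fakeSyndrome])
      ((hinc.adj c w).2 ⟨hwc.symm, q, hcq, hwq⟩) i
    unfold iidPrior
    rw [hinc.minSumApp_eq hg s i hwc.symm hcq hwq, hinc.minSumApp_eq hg _ i hwc.symm hcq hwq,
      h₁, h₂]
  -- No two checks are at distance five here, so `c` is the only unsatisfied one.
  · have hfake : s = fakeSyndrome c := by
      funext c'
      by_cases hcc : c' = c
      · simp [fakeSyndrome, hcc, hc]
      · have hne : s c' ≠ 1 := fun h => by
          have := (hdist c' c h hc hcc).trans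
            (toricLattice_dist_le_four hm hn (by omega) (by omega) c' c)
          omega
        have : ∀ z : ZMod 2, z ≠ 1 → z = 0 := by decide
        simp [fakeSyndrome, hcc, this _ hne]
    rw [hfake]
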